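/- For a finite group $G$ let $d(G)$ be the least integer $d\ge 0$ such that $G$ embeds in the symmetric group $S_d$, and let $\Delta(G)=d(G)/|G|$. (1) Let $(G_n)$ be a sequence of finite groups with $|G_n|\to\infty$ such that $\lim_{n\to\infty}\Delta(G_n)$ exists and is positive. Then this limit equals $1/l$ for some positive integer $l$. (2) Call $a\in\mathbb R$ a limit point of $\Delta(G)$ as $|G|\to\infty$ if for all $\varepsilon>0$ and all $N$ there is a finite group $G$ with $|G|>N$ and $|\Delta(G)-a|<\varepsilon$. The nonzero limit points of $\Delta(G)$ as $|G|\to\infty$ are exactly the numbers $1/n$ with $n$ a positive integer. Moreover, the nonzero accumulation points of the set $\{\Delta(G) : G \text{ a finite group}\}\subset\mathbb R$ (points every punctured neighbourhood of which meets the set) are exactly the numbers $1/n$ with $n\ge 2$. (The value $1$ is taken by groups of arbitrarily large order, but it is an isolated point of the set.) (3) For every $c>0$ there is a constant $C$, depending only on $c$, such that every finite group $G$ with $d(G)\ge c|G|$ satisfies $\bigl|d(G)-|G|/m\bigr|\le C$ for some positive integer $m$. -/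

import Mathlib

open Filter Topology

universe u

/-- The degree `d(G)`: the least `n` such that `G` embeds in the symmetric group `S_n`.
For finite `G` the set is nonempty by Cayley's theorem, so the infimum is attained. -/
noncomputable def groupDegree (G : Type u) [Group G] : ℕ :=
  sInf {n : ℕ | ∃ f : G →* Equiv.Perm (Fin n), Function.Injective f}

/-- The relative degree `Δ(G) = d(G) / |G|`. -/
noncomputable def relDegree (G : Type u) [Group G] : ℝ :=
  (groupDegree G : ℝ) / (Nat.card G : ℝ)

/-- The set of all values `Δ(G)`, `G` a finite group. -/
def relDegreeSet : Set ℝ :=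
  {x : ℝ | ∃ (G : Type u) (_ : Group G) (_ : Finite G), x = relDegree G}

/-- `a` is a limit point of `Δ(G)` as `|G| → ∞`: every neighbourhood of `a` contains `Δ(G)` for
finite groups `G` of arbitrarily large order. -/
def IsRelDegreeLimitPoint (a : ℝ) : Prop :=
  ∀ ε : ℝ, 0 < ε → ∀ N : ℕ, ∃ (G : Type u) (_ : Group G) (_ : Finite G),
    N < Nat.card G ∧ |relDegree G - a| < ε

/-! Suppose d(G) ≥ c|G|. If H and L meet trivially, G acts faithfully on G/H ⊔ G/L, so H and L
cannot both have order above about 2/c. This forces a nontrivial G to contain a cyclic subgroup ⟨g⟩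
of prime-power order and index at most B = B(c) (`exists_index_zpowers_le`).

Let z generate the subgroup of prime order in ⟨g⟩, and let m be the largest order of a subgroup H
missing z. A faithful action moves z, so some point stabilizer misses z and d(G) ≥ |G|/m. A
maximizing H meets ⟨g⟩ trivially, so d(G) ≤ |G|/m + B. This is `groupDegree_estimate`. Dividing by
|G| confines Δ(G) to intervals just above the numbers 1/m; since Δ(G) ≤ 1, the value m = 1 gives
Δ(G) = 1 exactly. Conversely, C_p × C_n has degree between p and p + n, strictly above p if n ≥ 2,
so letting p grow realizes 1/n.

The cyclic subgroup arises as follows. Large coprime prime powers in |G| give large disjoint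
subgroups, so some Sylow subgroup P has bounded index. A self-centralizing normal abelian A ≤ P has
a cyclic subgroup of bounded index, hence one normal in P. A bounded power of its generator has
centralizer of index at most 4 (`DisjointSubgroupsBounded.index_centralizer_pow_le`), and that
centralizer is only boundedly larger than A (`index_zpowers_le_of_centralizer_eq`). -/

/-! ### Degree bounds from coset spaces and point stabilizers -/

theorem groupDegree_le_card_of_injective {G : Type u} [Group G] {X : Type*} [Finite X]
    (f : G →* Equiv.Perm X) (hf : Function.Injective f) : groupDegree G ≤ Nat.card X := by
  let e : Equiv.Perm X ≃* Equiv.Perm (Fin (Nat.card X)) := (Finite.equivFin X).permCongrHom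
  exact Nat.sInf_le ⟨e.toMonoidHom.comp f, e.injective.comp hf⟩

theorem exists_injective_perm_groupDegree (G : Type u) [Group G] [Finite G] :
    ∃ f : G →* Equiv.Perm (Fin (groupDegree G)), Function.Injective f := by
  let e : Equiv.Perm G ≃* Equiv.Perm (Fin (Nat.card G)) := (Finite.equivFin G).permCongrHom
  exact Nat.sInf_mem
    (s := {n : ℕ | ∃ f : G →* Equiv.Perm (Fin n), Function.Injective f})
    ⟨_, e.toMonoidHom.comp (MulAction.toPermHom G G), e.injective.comp MulAction.toPerm_injective⟩

theorem groupDegree_le_card (G : Type u) [Group G] [Finite G] : groupDegree G ≤ Nat.card G :=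
  groupDegree_le_card_of_injective (MulAction.toPermHom G G) MulAction.toPerm_injective

/-- Two subgroups meeting trivially give a faithful action on the union of their coset spaces. -/
theorem groupDegree_le_index_add_index {G : Type u} [Group G] [Finite G] {H L : Subgroup G}
    (h : Disjoint H L) : groupDegree G ≤ H.index + L.index := by
  have key : Function.Injective (MulAction.toPermHom G ((G ⧸ H) ⊕ (G ⧸ L))) := by
    rw [injective_iff_map_eq_one]
    intro g hg
    have hH : g ∈ H := by
      have := Equiv.ext_iff.mp hg (Sum.inl ((1 : G) : G ⧸ H))
      simpa [MulAction.toPermHom_apply, QuotientGroup.eq, eq_comm] using this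
    have hL : g ∈ L := by
      have := Equiv.ext_iff.mp hg (Sum.inr ((1 : G) : G ⧸ L))
      simpa [MulAction.toPermHom_apply, QuotientGroup.eq, eq_comm] using this
    exact Subgroup.disjoint_def.mp h hH hL
  simpa [Nat.card_sum, Subgroup.index_eq_card] using groupDegree_le_card_of_injective _ key

/-- In a faithful action some point stabilizer misses a given nontrivial element. -/
theorem exists_subgroup_index_le_of_injective {G : Type u} [Group G] {n : ℕ}
    {f : G →* Equiv.Perm (Fin n)} (hf : Function.Injective f) {z : G} (hz : z ≠ 1) :
    ∃ H : Subgroup G, z ∉ H ∧ H.index ≤ n := by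
  obtain ⟨i, hi⟩ : ∃ i, f z i ≠ i := by
    by_contra! h
    exact hz (hf (by ext i; simp [h i]))
  let : MulAction G (Fin n) := MulAction.compHom (Fin n) f
  refine ⟨MulAction.stabilizer G i, fun h => hi h, ?_⟩
  rw [MulAction.index_stabilizer]
  simpa using Set.ncard_le_card (MulAction.orbit G i)

theorem card_le_mul_groupDegree {G : Type u} [Group G] [Finite G] {z : G} (hz : z ≠ 1) {m : ℕ}
    (hm : ∀ H : Subgroup G, z ∉ H → Nat.card H ≤ m) : Nat.card G ≤ m * groupDegree G := by
  obtain ⟨f, hf⟩ := exists_injective_perm_groupDegree G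
  obtain ⟨H, hH, hi⟩ := exists_subgroup_index_le_of_injective hf hz
  rw [← H.card_mul_index]
  exact Nat.mul_le_mul (hm H hH) hi

/-! ### Disjoint subgroups and a Sylow subgroup of bounded index -/

/-- Of any two subgroups meeting trivially, one has order at most `K`. -/
def DisjointSubgroupsBounded (K : ℕ) (G : Type u) [Group G] : Prop :=
  ∀ H L : Subgroup G, Disjoint H L → Nat.card H ≤ K ∨ Nat.card L ≤ K

theorem disjointSubgroupsBounded_of_le_groupDegree {G : Type u} [Group G] [Finite G] {c : ℝ}
    (hc : 0 < c) (h : c * (Nat.card G : ℝ) ≤ (groupDegree G : ℝ)) :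
    DisjointSubgroupsBounded ⌈2 / c⌉₊ G := by
  intro H L hHL
  by_contra! hcon
  -- Order above 2/c means index below c|G|/2, so two such indices sum to less than c|G|.
  have aux (H : Subgroup G) (hH : ⌈2 / c⌉₊ < Nat.card H) :
      (H.index : ℝ) < c * (Nat.card G : ℝ) / 2 := by
    have h1 : 2 / c < Nat.card H := Nat.lt_of_ceil_lt hH
    have h2 : (Nat.card H : ℝ) * H.index = Nat.card G := mod_cast H.card_mul_index
    have h3 : (0 : ℝ) < H.index := by
      have : H.index ≠ 0 := Subgroup.FiniteIndex.index_ne_zero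
      positivity
    rw [div_lt_iff₀ hc] at h1
    rw [← h2]
    nlinarith
  have h1 : (groupDegree G : ℝ) ≤ H.index + L.index := mod_cast groupDegree_le_index_add_index hHL
  linarith [aux H hcon.1, aux L hcon.2]

/-- Subgroups of coprime orders are disjoint, so once a power of p above K divides |G|, powers of
every other prime dividing |G| are at most K. -/
theorem exists_sylow_index_dvd_factorial {K : ℕ} {G : Type u} [Group G] [Finite G]
    (h : DisjointSubgroupsBounded K G) :
    ∃ p : ℕ, p.Prime ∧ ∃ P : Sylow p G, P.index ∣ K.factorial := by
  by_cases hlarge : ∃ p k : ℕ, p.Prime ∧ p ^ k ∣ Nat.card G ∧ K < p ^ k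
  · obtain ⟨p, k, hp, hdvd, hlt⟩ := hlarge
    have := Fact.mk hp
    let P : Sylow p G := default
    refine ⟨p, hp, P, ?_⟩
    rw [Nat.dvd_iff_prime_pow_dvd_dvd]
    intro q j hq hqj
    rcases Nat.eq_zero_or_pos j with rfl | hj
    · simp
    have := Fact.mk hq
    have hpq : p ≠ q := by
      rintro rfl
      exact P.not_dvd_index ((dvd_pow_self p hj.ne').trans hqj)
    obtain ⟨H, hH⟩ := Sylow.exists_subgroup_card_pow_prime p hdvd
    obtain ⟨L, hL⟩ := Sylow.exists_subgroup_card_pow_prime q (hqj.trans P.index_dvd_card)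
    have hHL : Disjoint H L := Subgroup.disjoint_of_coprime_natCard (by
      rw [hH, hL]
      exact Nat.Coprime.pow _ _ ((Nat.coprime_primes hp hq).mpr hpq))
    rcases h H L hHL with h' | h'
    · omega
    · exact Nat.dvd_factorial (pow_pos hq.pos _) (hL ▸ h')
  -- Here every prime power dividing |G| is at most K, so |G| itself divides K! and the choice of
  -- the prime 2 is arbitrary.
  · push Not at hlarge
    have := Fact.mk Nat.prime_two
    let P : Sylow 2 G := default
    refine ⟨2, Nat.prime_two, P, P.index_dvd_card.trans ?_⟩
    rw [Nat.dvd_iff_prime_pow_dvd_dvd]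
    exact fun q j hq hqj => Nat.dvd_factorial (pow_pos hq.pos _) (hlarge q j hq hqj)

/-! ### Self-centralizing normal abelian subgroups of p-groups -/

theorem index_le_card_of_forall_mem {G : Type*} [Group G] {X : Type*} (H : Subgroup G) (f : G → X)
    (S : Set X) [Finite S] (hS : ∀ g, f g ∈ S) (hf : ∀ g h, f g = f h → g⁻¹ * h ∈ H) :
    H.index ≤ Nat.card S := by
  rw [Subgroup.index_eq_card]
  refine Nat.card_le_card_of_injective (fun q : G ⧸ H => (⟨f q.out, hS _⟩ : S)) ?_
  intro a b hab
  rw [← QuotientGroup.out_eq' a, ← QuotientGroup.out_eq' b, QuotientGroup.eq]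
  exact hf _ _ (congrArg Subtype.val hab)

/-- Under conjugation the number of fixed points on N is divisible by p, and 1 is one of them. -/
theorem IsPGroup.exists_mem_center_of_normal {p : ℕ} [Fact p.Prime] {P : Type*} [Group P]
    [Finite P] (hP : IsPGroup p P) (N : Subgroup P) [N.Normal] [Nontrivial N] :
    ∃ x ∈ N, x ≠ 1 ∧ x ∈ Subgroup.center P := by
  have hQ : IsPGroup p (ConjAct P) := hP
  have hdvd : p ∣ Nat.card N := by
    rcases (hP.to_subgroup N).card_eq_or_dvd with h | h
    · exact absurd h (Finite.one_lt_card (α := N)).ne'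
    · exact h
  obtain ⟨b, hb, hne⟩ := hQ.exists_fixed_point_of_prime_dvd_card_of_fixed_point N hdvd
    (a := 1) (fun g => by simp)
  refine ⟨b, b.2, fun h => hne (Subtype.ext h.symm), Subgroup.mem_center_iff.mpr fun g => ?_⟩
  have := congrArg Subtype.val (hb (ConjAct.toConjAct g))
  rw [ConjAct.Subgroup.val_conj_smul, ConjAct.toConjAct_smul] at this
  exact mul_inv_eq_iff_eq_mul.mp this

/-- Every finite `p`-group has a self-centralizing normal abelian subgroup. -/
theorem IsPGroup.exists_normal_centralizer_eq {p : ℕ} [Fact p.Prime] {P : Type*} [Group P]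
    [Finite P] (hP : IsPGroup p P) :
    ∃ A : Subgroup P, A.Normal ∧ Subgroup.centralizer (A : Set P) = A := by
  obtain ⟨A, hA⟩ := Set.Finite.exists_maximal
    (Set.toFinite {A : Subgroup P | A.Normal ∧ A ≤ Subgroup.centralizer (A : Set P)})
    ⟨⊥, inferInstance, by simp⟩
  have := hA.prop.1
  refine ⟨A, hA.prop.1, le_antisymm ?_ hA.prop.2⟩
  -- If the centralizer C exceeds a maximal normal abelian A, then C/A contains a nontrivial central
  -- element of P/A; the preimage of the group it generates is a larger normal abelian subgroup.
  by_contra hlt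
  let C : Subgroup P := Subgroup.centralizer (A : Set P)
  have : C.Normal := inferInstance
  let M : Subgroup (P ⧸ A) := C.map (QuotientGroup.mk' A)
  have : M.Normal := Subgroup.Normal.map inferInstance _ (QuotientGroup.mk'_surjective A)
  have : Nontrivial M := by
    obtain ⟨x, hxC, hxA⟩ := SetLike.not_le_iff_exists.mp hlt
    refine ⟨⟨⟨x, x, hxC, rfl⟩, 1, fun h => hxA ?_⟩⟩
    simpa [QuotientGroup.eq_one_iff] using congrArg Subtype.val h
  obtain ⟨_, ⟨g, hgC, rfl⟩, hx1, hxc⟩ := (hP.to_quotient A).exists_mem_center_of_normal M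
  set x : P ⧸ A := QuotientGroup.mk' A g with hx
  have hgA : g ∉ A := fun h => hx1 ((QuotientGroup.eq_one_iff g).mpr h)
  have : (Subgroup.zpowers x).Normal := ⟨fun n hn y => by
    obtain ⟨k, rfl⟩ := hn
    have := Subgroup.mem_center_iff.mp (Subgroup.zpow_mem _ hxc k) y
    rw [this]
    simp⟩
  let B : Subgroup P := (Subgroup.zpowers x).comap (QuotientGroup.mk' A)
  have hAB : A ≤ B := fun a ha => by
    have : QuotientGroup.mk' A a = 1 := (QuotientGroup.eq_one_iff a).mpr ha
    simp [B, this]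
  have hB : ∀ b ∈ B, ∃ k : ℤ, ∃ a ∈ A, b = g ^ k * a := by
    rintro b ⟨k, hk⟩
    refine ⟨k, (g ^ k)⁻¹ * b, ?_, by group⟩
    rw [← QuotientGroup.eq]
    exact hk
  have hcomm : ∀ a ∈ A, ∀ k : ℤ, Commute a (g ^ k) := fun a ha k =>
    Commute.zpow_right (Subgroup.mem_centralizer_iff.mp hgC a ha) k
  have hBmem : B ∈ {A : Subgroup P | A.Normal ∧ A ≤ Subgroup.centralizer (A : Set P)} := by
    refine ⟨Subgroup.Normal.comap inferInstance _, fun b hb => ?_⟩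
    rw [Subgroup.mem_centralizer_iff]
    intro c hc
    obtain ⟨k, a, ha, rfl⟩ := hB b hb
    obtain ⟨l, a', ha', rfl⟩ := hB c hc
    have h1 : Commute a' a := Subgroup.mem_centralizer_iff.mp (hA.prop.2 ha) a' ha'
    exact ((((Commute.refl g).zpow_zpow l k).mul_left (hcomm a' ha' k)).mul_right
      (((hcomm a ha l).symm).mul_left h1)).eq
  exact hgA (hA.le_of_ge hBmem hAB (Subgroup.mem_zpowers x))

/-- The n-torsion meets the cyclic group ⟨y⟩ in at most n elements, and its quotient by that
intersection embeds in A/⟨y⟩. -/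
theorem card_pow_eq_one_le_of_zpowers {A : Type*} [CommGroup A] [Finite A] (y : A) {n : ℕ}
    (hn : 0 < n) : Nat.card {a : A | a ^ n = 1} ≤ (Subgroup.zpowers y).index * n := by
  have := Fintype.ofFinite A
  classical
  let N : Subgroup A := (powMonoidHom n : A →* A).ker
  have hN : Nat.card {a : A | a ^ n = 1} = Nat.card N := rfl
  rw [hN, ← Subgroup.card_mul_index ((Subgroup.zpowers y).subgroupOf N), mul_comm]
  refine Nat.mul_le_mul ?_ ?_
  · exact Nat.le_of_dvd (Nat.pos_of_ne_zero Subgroup.FiniteIndex.index_ne_zero)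
      (Subgroup.relIndex_dvd_index_of_normal _ _)
  have := IsCyclic.card_pow_eq_one_le (α := Subgroup.zpowers y) hn
  rw [← Fintype.card_subtype, ← Nat.card_eq_fintype_card] at this
  refine le_trans (Nat.card_le_card_of_injective
    (fun a : (Subgroup.zpowers y).subgroupOf N =>
      (⟨⟨a.1.1, a.2⟩, Subtype.ext (a.1.2 : a.1.1 ^ n = 1)⟩ :
        {b : Subgroup.zpowers y // b ^ n = 1})) ?_) this
  intro a b hab
  exact Subtype.ext (Subtype.ext (congrArg (fun c => c.1.1) hab))

/-- A self-centralizing normal abelian subgroup `A` bounds the index of a cyclic subgroup of `A`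
whose generator has a large centralizer. -/
theorem index_zpowers_le_of_centralizer_eq {P : Type*} [Group P] [Finite P] {A : Subgroup P}
    [hA : A.Normal] (hAc : Subgroup.centralizer (A : Set P) = A) {y : P} (hy : y ∈ A) {q n : ℕ}
    (hq : (Subgroup.centralizer {y}).index ≤ q) (hn : (Subgroup.zpowers y).relIndex A ≤ n) :
    (Subgroup.zpowers y).index ≤ n * ((n * n) ^ n * q) := by
  set Q := Subgroup.centralizer {y} with hQ
  have hcomm : ∀ a ∈ A, ∀ b ∈ A, a * b = b * a := fun a ha b hb =>
    Subgroup.mem_centralizer_iff.mp (hAc.ge hb) a ha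
  let _ : CommGroup A := { (inferInstance : Group A) with
    mul_comm := fun a b => Subtype.ext (hcomm a a.2 b b.2) }
  let y' : A := ⟨y, hy⟩
  have hmap : (Subgroup.zpowers y).subgroupOf A = Subgroup.zpowers y' := by
    ext a
    simp only [Subgroup.mem_subgroupOf, Subgroup.mem_zpowers_iff]
    exact exists_congr fun k => by rw [Subtype.ext_iff]; rfl
  set m := (Subgroup.zpowers y').index with hm
  have hmn : m ≤ n := by rw [hm, ← hmap]; exact hn
  have hm0 : 0 < m := Nat.pos_of_ne_zero Subgroup.FiniteIndex.index_ne_zero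
  have hpow : ∀ a : A, ∃ k : ℤ, y ^ k = (a : P) ^ m := fun a => by
    obtain ⟨k, hk⟩ := (Subgroup.zpowers y').pow_index_mem a
    exact ⟨k, by simpa [y'] using congrArg Subtype.val hk⟩
  have hQy : ∀ g ∈ Q, Commute g y := fun g hg => (Subgroup.mem_centralizer_singleton_iff.mp hg)
  have hconj : ∀ g ∈ Q, ∀ a : A, g * (a : P) ^ m * g⁻¹ = (a : P) ^ m := fun g hg a => by
    obtain ⟨k, hk⟩ := hpow a
    rw [← hk, ((hQy g hg).zpow_right k).eq, mul_inv_cancel_right]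
  have hAQ : A ≤ Q := fun a ha => Subgroup.mem_centralizer_singleton_iff.mpr (hcomm a ha y hy)
  let T := A ⧸ Subgroup.zpowers y'
  -- The commutator of g with a is m-torsion: a ^ m lies in ⟨y⟩, which g centralizes.
  let δ : Q → A → A := fun g a => ⟨g * a * g⁻¹, hA.conj_mem a a.2 g⟩ * a⁻¹
  have hδ : ∀ g a, δ g a ^ m = 1 := fun g a => by
    rw [mul_pow, inv_pow, mul_inv_eq_one]
    apply Subtype.ext
    show ((g : P) * a * (g : P)⁻¹) ^ m = (a : P) ^ m
    rw [conj_pow]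
    exact hconj g g.2 a
  -- If g and h have equal commutators with representatives of A/⟨y⟩, then g⁻¹h centralizes these
  -- and y, hence all of A, so it lies in A. There are at most n representatives and n * n torsion
  -- values.
  have hrel : A.relIndex Q ≤ (n * n) ^ n := by
    have h1 := index_le_card_of_forall_mem (A.subgroupOf Q)
      (fun g (t : T) => (⟨δ g t.out, hδ _ _⟩ : {a : A | a ^ m = 1})) Set.univ
      (fun _ => Set.mem_univ _) ?_
    · rw [Nat.card_univ, Nat.card_fun] at h1
      have h2 : Nat.card {a : A | a ^ m = 1} ≤ n * n :=
        (card_pow_eq_one_le_of_zpowers y' hm0).trans (Nat.mul_le_mul hmn hmn)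
      have h3 : Nat.card T ≤ n := hmn
      refine h1.trans ((Nat.pow_le_pow_left h2 _).trans (Nat.pow_le_pow_right ?_ h3))
      exact Nat.mul_pos (hm0.trans_le hmn) (hm0.trans_le hmn)
    · intro g h hgh
      have h1 : ∀ t : T, Commute ((g : P)⁻¹ * h) (t.out : A) := fun t => by
        have h2 : δ g t.out = δ h t.out := congrArg Subtype.val (congrFun hgh t)
        have h3 : (g : P) * t.out * (g : P)⁻¹ = h * t.out * (h : P)⁻¹ := by
          simpa [δ] using congrArg Subtype.val h2
        have h4 : (g : P) * t.out = h * t.out * (h : P)⁻¹ * g := by rw [← h3]; group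
        show (g : P)⁻¹ * h * t.out = t.out * ((g : P)⁻¹ * h)
        calc (g : P)⁻¹ * h * t.out = (g : P)⁻¹ * (h * t.out * (h : P)⁻¹ * g) * ((g : P)⁻¹ * h) := by group
          _ = _ := by rw [← h4]; group
      have h2 : Commute ((g : P)⁻¹ * h) y := hQy _ (Q.mul_mem (Q.inv_mem g.2) h.2)
      show (g : P)⁻¹ * h ∈ A
      rw [← hAc, Subgroup.mem_centralizer_iff]
      intro a ha
      obtain ⟨k, hk⟩ : (QuotientGroup.mk ⟨a, ha⟩ : T).out⁻¹ * ⟨a, ha⟩ ∈ Subgroup.zpowers y' := by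
        rw [← QuotientGroup.eq, QuotientGroup.out_eq']
      have h3 : a = ((QuotientGroup.mk ⟨a, ha⟩ : T).out : A) * y ^ k := by
        have := congrArg Subtype.val hk
        simp only [Subgroup.coe_zpow, Subgroup.coe_mul, Subgroup.coe_inv, y'] at this
        rw [this, mul_inv_cancel_left]
      rw [h3]
      exact ((h1 _).mul_right (h2.zpow_right k)).symm.eq
  rw [← Subgroup.relIndex_mul_index ((Subgroup.zpowers_le).mpr hy),
    ← Subgroup.relIndex_mul_index hAQ]
  exact Nat.mul_le_mul hn (Nat.mul_le_mul hrel hq)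

/-! ### Abelian groups -/

theorem DisjointSubgroupsBounded.of_injective {K : ℕ} {G G' : Type*} [Group G] [Group G']
    (h : DisjointSubgroupsBounded K G') (f : G →* G') (hf : Function.Injective f) :
    DisjointSubgroupsBounded K G := by
  intro H L hHL
  have e (H : Subgroup G) : Nat.card (H.map f) = Nat.card H :=
    (Nat.card_congr (H.equivMapOfInjective f hf).toEquiv).symm
  rw [← e H, ← e L]
  exact h _ _ (Subgroup.disjoint_map hf hHL)

theorem DisjointSubgroupsBounded.exists_index_zpowers_le {K : ℕ} {A : Type*} [CommGroup A]
    [Finite A] (h : DisjointSubgroupsBounded K A) :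
    ∃ x : A, (Subgroup.zpowers x).index ≤ K * K := by
  classical
  obtain ⟨ι, _, n, hn, ⟨e⟩⟩ := CommGroup.equiv_prod_multiplicative_zmod_of_finite A
  have hT := h.of_injective e.symm.toMonoidHom e.symm.injective
  have (i : ι) : NeZero (n i) := ⟨by have := hn i; omega⟩
  suffices H : ∃ x : (i : ι) → Multiplicative (ZMod (n i)), (Subgroup.zpowers x).index ≤ K * K by
    obtain ⟨x, hx⟩ := H
    refine ⟨e.symm x, ?_⟩
    have := Subgroup.index_map_of_bijective (f := e.symm.toMonoidHom) e.symm.bijective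
      (Subgroup.zpowers x)
    rw [MonoidHom.map_zpowers] at this
    exact this.trans_le hx
  let F : Finset ι → Subgroup ((i : ι) → Multiplicative (ZMod (n i))) := fun S =>
    Subgroup.pi Set.univ (fun i => if i ∈ S then ⊤ else ⊥)
  have hF : ∀ S, Nat.card (F S) = ∏ i ∈ S, n i := fun S => by
    have : Nat.card (F S) = Nat.card ((i : ι) → (if i ∈ S then ⊤ else ⊥ :
        Subgroup (Multiplicative (ZMod (n i))))) :=
      Nat.card_congr (Equiv.Set.univPi (fun i => ((if i ∈ S then ⊤ else ⊥ :
        Subgroup (Multiplicative (ZMod (n i)))) : Set (Multiplicative (ZMod (n i))))))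
    rw [this, Nat.card_pi, ← Finset.prod_subset (Finset.subset_univ S)]
    · refine Finset.prod_congr rfl fun i hi => ?_
      rw [if_pos hi, Subgroup.card_top, Nat.card_congr Multiplicative.toAdd, Nat.card_zmod]
    · intro i _ hi
      rw [if_neg hi, Subgroup.card_bot]
  have hdisj : ∀ S, Disjoint (F S) (F Sᶜ) := fun S => by
    rw [Subgroup.disjoint_def]
    intro x h1 h2
    funext i
    have h1 := h1 i (Set.mem_univ i)
    have h2 := h2 i (Set.mem_univ i)
    by_cases hi : i ∈ S <;> simp_all
  have hcard : Nat.card ((i : ι) → Multiplicative (ZMod (n i))) = ∏ i, n i := by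
    rw [← hF, ← Subgroup.card_top]
    congr 2
    ext x
    simp [F, Subgroup.mem_pi]
  have hK : 1 ≤ K := by simpa using hT ⊥ ⊥ disjoint_bot_left
  by_cases hlarge : ∃ S : Finset ι, K < ∏ i ∈ S, n i
  -- For a minimal set S of cyclic factors with product above K, removing one factor leaves at most
  -- K, and the complementary factors contribute at most K by disjointness. The removed factor is
  -- the cyclic subgroup sought.
  · obtain ⟨S, hS⟩ := Set.Finite.exists_minimal
      (Set.toFinite {S : Finset ι | K < ∏ i ∈ S, n i}) hlarge
    obtain ⟨i, hi⟩ : S.Nonempty := by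
      rw [Finset.nonempty_iff_ne_empty]
      rintro rfl
      have := hS.prop
      simp at this
      omega
    have h1 : ∏ j ∈ S.erase i, n j ≤ K := by
      by_contra! hlt
      exact Finset.notMem_erase i S (hS.le_of_le hlt (Finset.erase_subset i S) hi)
    have h2 : ∏ j ∈ Sᶜ, n j ≤ K := by
      rcases hT _ _ (hdisj S) with h' | h' <;> rw [hF] at h'
      · exact absurd hS.prop (not_lt.mpr h')
      · exact h'
    refine ⟨Pi.mulSingle i (Multiplicative.ofAdd 1), ?_⟩
    have h3 := (Subgroup.zpowers (Pi.mulSingle i (Multiplicative.ofAdd 1) :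
      (i : ι) → Multiplicative (ZMod (n i)))).card_mul_index
    rw [Nat.card_zpowers, orderOf_piMulSingle, orderOf_ofAdd_eq_addOrderOf, ZMod.addOrderOf_one,
      hcard, ← Finset.prod_mul_prod_compl S, ← Finset.mul_prod_erase S n hi, mul_assoc] at h3
    rw [Nat.eq_of_mul_eq_mul_left (NeZero.pos (n i)) h3]
    exact Nat.mul_le_mul h1 h2
  · push Not at hlarge
    refine ⟨1, ?_⟩
    rw [Subgroup.zpowers_one_eq_bot, Subgroup.index_bot, hcard]
    nlinarith [hlarge Finset.univ]

/-! ### Action on a normal cyclic subgroup -/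

/-- Lifting the exponent: each p-th power contributes exactly one factor p, because 1 + v + ⋯ + v ^
(p - 1) ≡ p mod p². For p = 2 this needs v ≡ 1 mod 4. -/
theorem Int.exists_pow_prime_pow_sub_one {p : ℕ} (hp : p.Prime) {u : ℤ} (hu : (p : ℤ) ∣ u - 1)
    (hu2 : p = 2 → (4 : ℤ) ∣ u - 1) (t : ℕ) :
    ∃ w : ℤ, ¬ (p : ℤ) ∣ w ∧ u ^ p ^ t - 1 = (u - 1) * (p ^ t * w) := by
  have hp1 : ¬ (p : ℤ) ∣ 1 := fun h => hp.one_lt.ne' (by simpa using Int.natAbs_dvd_natAbs.mpr h)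
  induction t with
  | zero => exact ⟨1, hp1, by simp⟩
  | succ t ih =>
    obtain ⟨w, hw, h⟩ := ih
    set v := u ^ p ^ t with hv
    obtain ⟨w', hw', h'⟩ : ∃ w' : ℤ, ¬ (p : ℤ) ∣ w' ∧ ∑ i ∈ Finset.range p, v ^ i = p * w' := by
      rcases hp.eq_two_or_odd' with rfl | hodd
      · obtain ⟨s, hs⟩ := hu2 rfl
        refine ⟨1 + 2 * (s * (2 ^ t * w)), ?_, ?_⟩
        · push_cast
          omega
        · rw [Finset.sum_range_succ, Finset.sum_range_one]
          have : v = 1 + 4 * s * (2 ^ t * w) := by rw [← hs]; push_cast at h; linarith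
          rw [pow_zero, pow_one, this]
          push_cast
          ring
      · obtain ⟨s, hs⟩ := hu
        obtain ⟨r, hr⟩ := odd_sq_dvd_geom_sum₂_sub (1 : ℤ) (s * (p ^ t * w)) hodd
        have : (1 : ℤ) + p * (s * (p ^ t * w)) = v := by rw [← mul_assoc, ← hs, ← h]; ring
        simp only [this, one_pow, mul_one] at hr
        refine ⟨1 + p * r, fun hd => hp1 ((Int.dvd_add_left (dvd_mul_right _ r)).mp hd), ?_⟩
        linear_combination hr
    refine ⟨w * w', fun hd => ?_, ?_⟩
    · rcases (Nat.prime_iff_prime_int.mp hp).dvd_or_dvd hd with hd | hd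
      exacts [hw hd, hw' hd]
    · rw [pow_succ p, pow_mul, ← mul_geom_sum, h', h]
      ring

theorem Int.exists_geom_sum_prime_pow {p : ℕ} (hp : p.Prime) {u : ℤ} (hu : (p : ℤ) ∣ u - 1)
    (hu2 : p = 2 → (4 : ℤ) ∣ u - 1) (t : ℕ) :
    ∃ w : ℤ, ¬ (p : ℤ) ∣ w ∧ ∑ i ∈ Finset.range (p ^ t), u ^ i = p ^ t * w := by
  by_cases h1 : u = 1
  · refine ⟨1, fun h => hp.one_lt.ne' (by simpa using Int.natAbs_dvd_natAbs.mpr h), ?_⟩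
    simp [h1]
  · obtain ⟨w, hw, h⟩ := Int.exists_pow_prime_pow_sub_one hp hu hu2 t
    refine ⟨w, hw, mul_left_cancel₀ (sub_ne_zero.mpr h1) ?_⟩
    rw [mul_geom_sum, h]

section Conjugation

variable {P : Type*} [Group P] {g y : P} {u : ℤ}

theorem zpow_mul_pow_of_mul_eq (h : y * g = g * y ^ u) (i : ℤ) (n : ℕ) :
    y ^ i * g ^ n = g ^ n * y ^ (i * u ^ n) := by
  have h1 : ∀ i : ℤ, y ^ i * g = g * y ^ (i * u) := fun i => by
    have : SemiconjBy g (y ^ u) y := h.symm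
    have := this.zpow_right i
    rw [mul_comm, zpow_mul]
    exact this.eq.symm
  induction n generalizing i with
  | zero => simp
  | succ n ih => rw [pow_succ, ← mul_assoc, ih, mul_assoc, h1, ← mul_assoc, pow_succ, mul_assoc i]

theorem mul_zpow_pow_of_mul_eq (h : y * g = g * y ^ u) (i : ℤ) (n : ℕ) :
    (g * y ^ i) ^ n = g ^ n * y ^ (i * ∑ j ∈ Finset.range n, u ^ j) := by
  induction n with
  | zero => simp
  | succ n ih =>
    rw [pow_succ', ih, mul_assoc, ← mul_assoc (y ^ i), zpow_mul_pow_of_mul_eq h, mul_assoc,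
      ← zpow_add, ← mul_assoc, ← pow_succ', Finset.sum_range_succ, mul_add,
      add_comm (i * u ^ n)]

end Conjugation

/-- The p-adic valuation of e truncated at t; the truncation also covers e = 0. -/
theorem exists_le_pow_dvd_and (p : ℕ) (e : ℤ) (t : ℕ) :
    ∃ s ≤ t, ∃ e' : ℤ, e = p ^ s * e' ∧ (s = t ∨ ¬ (p : ℤ) ∣ e') := by
  induction t with
  | zero => exact ⟨0, le_rfl, e, by simp, Or.inl rfl⟩
  | succ t ih =>
    obtain ⟨s, hs, e', he, h⟩ := ih
    by_cases hd : (p : ℤ) ∣ e'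
    · obtain ⟨r, rfl⟩ := hd
      have hst : s = t := h.resolve_right (not_not.mpr (dvd_mul_right _ _))
      exact ⟨t + 1, le_rfl, r, by rw [he, hst]; ring, Or.inl rfl⟩
    · exact ⟨s, hs.trans (Nat.le_succ t), e', he, Or.inr hd⟩

theorem Int.exists_mul_add_mul_pow_eq_one {p : ℕ} (hp : p.Prime) {w : ℤ} (hw : ¬ (p : ℤ) ∣ w)
    (a : ℕ) : ∃ α β : ℤ, α * w + β * (p : ℤ) ^ a = 1 :=
  ((Prime.coprime_iff_not_dvd (Nat.prime_iff_prime_int.mp hp)).mpr hw).symm.pow_right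

/-- If `g` acts on a large normal cyclic subgroup `⟨y⟩` by an exponent congruent to `1`, then it
commutes with a bounded power of `y`. -/
theorem DisjointSubgroupsBounded.commute_pow {K p : ℕ} [hp : Fact p.Prime] {P : Type*} [Group P]
    [Finite P] (hP : IsPGroup p P) (hT : DisjointSubgroupsBounded K P) {y : P}
    [hD : (Subgroup.zpowers y).Normal] (hK : K < orderOf y) {g : P} {u : ℤ}
    (h : y * g = g * y ^ u) (hu : (p : ℤ) ∣ u - 1) (hu2 : p = 2 → (4 : ℤ) ∣ u - 1) :
    Commute g (y ^ p ^ (2 * Nat.log p K)) := by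
  obtain ⟨a, ha⟩ := IsPGroup.iff_orderOf.mp hP y
  have hya : ∀ i : ℤ, y ^ ((p : ℤ) ^ a * i) = 1 := fun i => by
    rw [← orderOf_dvd_iff_zpow_eq_one, ha]
    push_cast
    exact dvd_mul_right _ _
  set D := Subgroup.zpowers y with hDdef
  obtain ⟨t, ht⟩ := IsPGroup.iff_orderOf.mp (hP.to_quotient D) (g : P ⧸ D)
  have hgD : ∀ k : ℕ, g ^ k ∈ D ↔ p ^ t ∣ k := fun k => by
    rw [← ht, orderOf_dvd_iff_pow_eq_one, ← QuotientGroup.mk_pow, QuotientGroup.eq_one_iff]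
  obtain ⟨e, he⟩ := Subgroup.mem_zpowers_iff.mp ((hgD (p ^ t)).mpr dvd_rfl)
  obtain ⟨s, hst, e', rfl, hor⟩ := exists_le_pow_dvd_and p e t
  set k := Nat.log p K with hk
  have hK0 : K ≠ 0 := by
    rintro rfl
    have := hT ⊥ ⊥ disjoint_bot_left
    simp at this
  have hps : p ^ s ≤ K := by
    set u' := u ^ p ^ (t - s) with hu'
    have hdvd : u - 1 ∣ u' - 1 := by simpa using sub_dvd_pow_sub_pow u 1 (p ^ (t - s))
    have h' : y * g ^ p ^ (t - s) = g ^ p ^ (t - s) * y ^ u' := by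
      simpa using zpow_mul_pow_of_mul_eq h 1 (p ^ (t - s))
    obtain ⟨w, hw, hsum⟩ := Int.exists_geom_sum_prime_pow hp.out (hu.trans hdvd)
      (fun h2 => (hu2 h2).trans hdvd) s
    obtain ⟨α, β, hαβ⟩ := Int.exists_mul_add_mul_pow_eq_one hp.out hw a
    -- Correcting g ^ p ^ (t - s) by a power of y makes its p ^ s-th power trivial while its order
    -- modulo D remains p ^ s. So ⟨x⟩ is disjoint from D, and since D has order above K, p ^ s ≤ K.
    set x := g ^ p ^ (t - s) * y ^ (-(e' * α)) with hx
    have hx1 : x ^ p ^ s = 1 := by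
      rw [hx, mul_zpow_pow_of_mul_eq h', ← pow_mul, ← pow_add, Nat.sub_add_cancel hst, ← he, hsum,
        ← zpow_add, ← hya (p ^ s * e' * β)]
      congr 1
      linear_combination (-(p : ℤ) ^ s * e') * hαβ
    have hxk : ∀ n : ℕ, x ^ n ∈ D → p ^ s ∣ n := fun n hn => by
      have hmk : (x : P ⧸ D) = ((g ^ p ^ (t - s) : P) : P ⧸ D) := by
        rw [eq_comm, QuotientGroup.eq, hx, inv_mul_cancel_left]
        exact Subgroup.zpow_mem_zpowers y _
      rw [← QuotientGroup.eq_one_iff, QuotientGroup.mk_pow, hmk, ← QuotientGroup.mk_pow,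
        QuotientGroup.eq_one_iff, ← pow_mul, hgD] at hn
      refine Nat.dvd_of_mul_dvd_mul_left (pow_pos hp.out.pos (t - s)) ?_
      rwa [← pow_add, Nat.sub_add_cancel hst]
    have hdisj : Disjoint (Subgroup.zpowers x) D := by
      rw [Subgroup.disjoint_def]
      intro b hb hbD
      obtain ⟨n, rfl⟩ := (mem_powers_iff_mem_zpowers.mpr hb)
      obtain ⟨r, rfl⟩ := hxk n hbD
      show x ^ _ = 1
      rw [pow_mul, hx1, one_pow]
    rcases hT _ _ hdisj with h1 | h1
    · rw [Nat.card_zpowers] at h1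
      refine (Nat.le_of_dvd (orderOf_pos x) (hxk _ ?_)).trans h1
      rw [pow_orderOf_eq_one]
      exact D.one_mem
    · rw [Nat.card_zpowers] at h1
      omega
  have hsk : s ≤ k := Nat.le_log_of_pow_le hp.out.one_lt hps
  -- If s = t, then g ^ p ^ s commutes with y because it lies in a p ^ s-th power's worth of ⟨y⟩;
  -- otherwise e' is invertible modulo the order of y, and y ^ p ^ s is a power of g.
  have hcomm : Commute (g ^ p ^ k) (y ^ p ^ k) := by
    rcases hor with rfl | hne
    · have h1 : Commute (g ^ p ^ s) y := by
        rw [← he]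
        exact (Commute.refl y).zpow_left _
      rw [← Nat.add_sub_cancel' hsk, pow_add, pow_mul g]
      exact (h1.pow_left _).pow_right _
    · have h1 : Commute g (y ^ p ^ s) := by
        obtain ⟨α, β, hαβ⟩ := Int.exists_mul_add_mul_pow_eq_one hp.out hne a
        have h2 : y ^ p ^ s = (g ^ p ^ t) ^ α := by
          rw [← he, ← zpow_mul, ← mul_one (y ^ ((p : ℤ) ^ s * e' * α)), ← hya (p ^ s * β),
            ← zpow_add, ← zpow_natCast]
          congr 1
          push_cast
          linear_combination (-(p : ℤ) ^ s) * hαβ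
        rw [h2]
        exact ((Commute.refl g).pow_right _).zpow_right _
      rw [← Nat.add_sub_cancel' hsk, pow_add, pow_mul y]
      exact (h1.pow_right _).pow_left _
  -- Commutation says the order of y divides p ^ k * (u ^ p ^ k - 1), which is p ^ (2 * k) * (u - 1)
  -- up to a factor prime to p.
  obtain ⟨w, hw, hsub⟩ := Int.exists_pow_prime_pow_sub_one hp.out hu hu2 k
  obtain ⟨α, β, hαβ⟩ := Int.exists_mul_add_mul_pow_eq_one hp.out hw a
  have h1 : y ^ ((p : ℤ) ^ k * (u ^ p ^ k - 1)) = 1 := by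
    have h2 := zpow_mul_pow_of_mul_eq h ((p : ℤ) ^ k) (p ^ k)
    have h3 : y ^ ((p : ℤ) ^ k) = y ^ p ^ k := by rw [← zpow_natCast]; push_cast; rfl
    rw [h3, ← hcomm.eq] at h2
    rw [mul_sub, mul_one, zpow_sub, h3, ← mul_left_cancel h2, mul_inv_cancel]
  have h4 : y ^ ((p : ℤ) ^ (2 * k) * (u - 1)) = 1 := by
    have h5 : ((p : ℤ) ^ (2 * k) * (u - 1)) =
        (p : ℤ) ^ k * (u ^ p ^ k - 1) * α + (p : ℤ) ^ a * (β * (p : ℤ) ^ (2 * k) * (u - 1)) := by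
      rw [hsub]
      linear_combination (-(p : ℤ) ^ (2 * k) * (u - 1)) * hαβ
    rw [h5, zpow_add, hya, zpow_mul, h1, one_zpow, one_mul]
  have h6 := zpow_mul_pow_of_mul_eq h ((p : ℤ) ^ (2 * k)) 1
  have h7 : y ^ ((p : ℤ) ^ (2 * k)) = y ^ p ^ (2 * k) := by rw [← zpow_natCast]; push_cast; rfl
  rw [mul_sub, mul_one, zpow_sub, mul_inv_eq_one] at h4
  rw [pow_one, pow_one, h4, h7] at h6
  exact h6.symm

/-- Some u ^ p ^ k is 1 modulo the order of y, hence modulo p, and Frobenius fixes u in the prime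
field. -/
theorem IsPGroup.prime_dvd_sub_one_of_mul_eq {p : ℕ} [hp : Fact p.Prime] {P : Type*} [Group P]
    (hP : IsPGroup p P) {g y : P} {u : ℤ} (hy : y ≠ 1) (h : y * g = g * y ^ u) :
    (p : ℤ) ∣ u - 1 := by
  obtain ⟨k, hk⟩ := isPGroup_iff_pow_pow_eq_one.mp hP g
  have h1 := zpow_mul_pow_of_mul_eq h 1 (p ^ k)
  rw [hk, mul_one, one_mul, one_mul, zpow_one] at h1
  have h2 : (orderOf y : ℤ) ∣ u ^ p ^ k - 1 := by
    rw [orderOf_dvd_iff_zpow_eq_one, zpow_sub, ← h1, zpow_one, mul_inv_cancel]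
  have h3 : (p : ℤ) ∣ u ^ p ^ k - 1 := (Int.natCast_dvd_natCast.mpr (hP.dvd_orderOf hy)).trans h2
  rw [← ZMod.intCast_zmod_eq_zero_iff_dvd] at h3 ⊢
  push_cast at h3 ⊢
  rwa [ZMod.pow_card_pow] at h3

theorem DisjointSubgroupsBounded.index_centralizer_pow_le {K p : ℕ} [hp : Fact p.Prime]
    {P : Type*} [Group P] [Finite P] (hP : IsPGroup p P) (hT : DisjointSubgroupsBounded K P)
    (hK2 : 2 ≤ K) (y : P) [hD : (Subgroup.zpowers y).Normal] :
    (Subgroup.centralizer {y ^ p ^ (2 * Nat.log p K)}).index ≤ 4 := by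
  obtain ⟨a, ha⟩ := IsPGroup.iff_orderOf.mp hP y
  have htop : (∀ g, Commute g (y ^ p ^ (2 * Nat.log p K))) →
      (Subgroup.centralizer {y ^ p ^ (2 * Nat.log p K)}).index ≤ 4 := fun h => by
    have : Subgroup.centralizer {y ^ p ^ (2 * Nat.log p K)} = ⊤ :=
      top_le_iff.mp fun g _ => Subgroup.mem_centralizer_singleton_iff.mpr (h g)
    simp [this]
  rcases le_or_gt (orderOf y) K with hle | hK
  · have hak : a ≤ 2 * Nat.log p K := by
      have := Nat.le_log_of_pow_le hp.out.one_lt (ha ▸ hle)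
      omega
    have h1 : y ^ p ^ (2 * Nat.log p K) = 1 := by
      rw [← orderOf_dvd_iff_pow_eq_one, ha]
      exact pow_dvd_pow p hak
    exact htop fun g => by simp [h1]
  have hy1 : y ≠ 1 := by
    rintro rfl
    simp at hK
    omega
  have hu : ∀ g : P, ∃ u : ℤ, y * g = g * y ^ u := fun g => by
    obtain ⟨u, hu⟩ := Subgroup.mem_zpowers_iff.mp
      (hD.conj_mem y (Subgroup.mem_zpowers y) g⁻¹)
    exact ⟨u, by rw [hu]; group⟩
  by_cases hp2 : p = 2
  · subst hp2
    obtain ⟨b, rfl⟩ : ∃ b, a = b + 2 := by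
      refine ⟨a - 2, (Nat.sub_add_cancel ?_).symm⟩
      by_contra! hlt
      have : 2 ^ a ≤ 2 ^ 1 := Nat.pow_le_pow_right two_pos (by omega)
      omega
    -- This has order 4, so an element centralizing it acts on ⟨y⟩ with u ≡ 1 mod 4. All conjugates
    -- of c lie in ⟨c⟩, which bounds the index of its centralizer by 4.
    set c := y ^ 2 ^ b with hc
    have hcle : Subgroup.centralizer {c} ≤
        Subgroup.centralizer {y ^ 2 ^ (2 * Nat.log 2 K)} := fun g hg => by
      obtain ⟨u, hu⟩ := hu g
      have hg : c * g = g * c := (Subgroup.mem_centralizer_singleton_iff.mp hg).symm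
      have h4 : (4 : ℤ) ∣ u - 1 := by
        have h1 := zpow_mul_pow_of_mul_eq hu (2 ^ b) 1
        have h2 : y ^ ((2 : ℤ) ^ b) = c := by rw [hc, ← zpow_natCast]; push_cast; rfl
        rw [pow_one, pow_one, h2, hg] at h1
        have h3 : (orderOf y : ℤ) ∣ 2 ^ b * (u - 1) := by
          rw [orderOf_dvd_iff_zpow_eq_one, mul_sub, mul_one, zpow_sub, ← mul_left_cancel h1, h2,
            mul_inv_cancel]
        rw [ha, pow_add] at h3
        push_cast at h3
        have := Int.dvd_of_mul_dvd_mul_left (by positivity) h3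
        exact this
      exact Subgroup.mem_centralizer_singleton_iff.mpr
        (hT.commute_pow hP hK hu (hP.prime_dvd_sub_one_of_mul_eq hy1 hu) fun _ => h4)
    refine (Nat.le_of_dvd (Nat.pos_of_ne_zero Subgroup.FiniteIndex.index_ne_zero)
      (Subgroup.index_dvd_of_le hcle)).trans ?_
    have hcard : Nat.card (Subgroup.zpowers c) = 4 := by
      rw [Nat.card_zpowers, hc, orderOf_pow, ha, Nat.gcd_eq_right (pow_dvd_pow 2 (by omega)),
        pow_add, Nat.mul_div_cancel_left _ (by positivity)]
      norm_num
    rw [← hcard]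
    refine index_le_card_of_forall_mem _ (fun g => g * c * g⁻¹) (Subgroup.zpowers c : Set P) ?_ ?_
    · intro g
      obtain ⟨v, hv⟩ := Subgroup.mem_zpowers_iff.mp (hD.conj_mem y (Subgroup.mem_zpowers y) g)
      refine Subgroup.mem_zpowers_iff.mpr ⟨v, ?_⟩
      rw [hc, ← conj_pow, ← hv, ← zpow_natCast, ← zpow_natCast, ← zpow_mul, ← zpow_mul, mul_comm]
    · intro g h hgh
      have hgh : g * c * g⁻¹ = h * c * h⁻¹ := hgh
      rw [Subgroup.mem_centralizer_singleton_iff]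
      have h1 : c = g⁻¹ * (h * c * h⁻¹) * g := by rw [← hgh]; group
      calc g⁻¹ * h * c = g⁻¹ * (h * c * h⁻¹) * g * (g⁻¹ * h) := by group
        _ = _ := by rw [← h1]
  · refine htop fun g => ?_
    obtain ⟨u, hu⟩ := hu g
    exact hT.commute_pow hP hK hu (hP.prime_dvd_sub_one_of_mul_eq hy1 hu) fun h => absurd h hp2

/-! ### Cyclic subgroups of bounded index -/

theorem relIndex_zpowers_pow_le {G : Type*} [Group G] [Finite G] (y : G) (n : ℕ) (hn : 0 < n) :
    (Subgroup.zpowers (y ^ n)).relIndex (Subgroup.zpowers y) ≤ n := by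
  have hle : Subgroup.zpowers (y ^ n) ≤ Subgroup.zpowers y :=
    Subgroup.zpowers_le.mpr (Subgroup.pow_mem _ (Subgroup.mem_zpowers y) n)
  have h1 := ((Subgroup.zpowers (y ^ n)).subgroupOf (Subgroup.zpowers y)).card_mul_index
  rw [Nat.card_congr (Subgroup.subgroupOfEquivOfLe hle).toEquiv, Nat.card_zpowers,
    Nat.card_zpowers] at h1
  have h2 : orderOf y ≤ orderOf (y ^ n) * n := by
    refine Nat.le_of_dvd (Nat.mul_pos (orderOf_pos _) hn) ?_
    rw [orderOf_dvd_iff_pow_eq_one, mul_comm, pow_mul, pow_orderOf_eq_one]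
  exact Nat.le_of_mul_le_mul_left (h1.trans_le h2) (orderOf_pos _)

theorem relIndex_zpowers_coe {G : Type*} [Group G] {H : Subgroup G} (x : H) :
    (Subgroup.zpowers (x : G)).relIndex H = (Subgroup.zpowers x).index := by
  have : (Subgroup.zpowers (x : G)).subgroupOf H = Subgroup.zpowers x := by
    ext a
    simp only [Subgroup.mem_subgroupOf, Subgroup.mem_zpowers_iff]
    exact exists_congr fun k => by rw [Subtype.ext_iff]; rfl
  rw [Subgroup.relIndex, this]

theorem IsPGroup.exists_index_zpowers_le {K p : ℕ} [hp : Fact p.Prime] {P : Type*} [Group P]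
    [Finite P] (hP : IsPGroup p P) (hT : DisjointSubgroupsBounded K P) (hK2 : 2 ≤ K) :
    ∃ y : P, (Subgroup.zpowers y).index ≤ K ^ 6 * ((K ^ 6 * K ^ 6) ^ K ^ 6 * 4) := by
  obtain ⟨A, hA, hAc⟩ := hP.exists_normal_centralizer_eq
  have hcomm : ∀ a ∈ A, ∀ b ∈ A, a * b = b * a := fun a ha b hb =>
    Subgroup.mem_centralizer_iff.mp (hAc.ge hb) a ha
  let _ : CommGroup A := { (inferInstance : Group A) with
    mul_comm := fun a b => Subtype.ext (hcomm a a.2 b b.2) }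
  obtain ⟨x, hx⟩ := (hT.of_injective A.subtype A.subtype_injective).exists_index_zpowers_le
  set n := (Subgroup.zpowers x).index with hn
  have hn0 : 0 < n := Nat.pos_of_ne_zero Subgroup.FiniteIndex.index_ne_zero
  set D := (Subgroup.zpowers (x : P)).normalCore with hD
  have hDle : D ≤ Subgroup.zpowers (x : P) := Subgroup.normalCore_le _
  have hxA : Subgroup.zpowers (x : P) ≤ A := Subgroup.zpowers_le.mpr x.2
  obtain ⟨y, hy⟩ : ∃ y, Subgroup.zpowers y = D := by
    have : IsCyclic (D.subgroupOf (Subgroup.zpowers (x : P))) := inferInstance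
    have : IsCyclic D := isCyclic_of_surjective (Subgroup.subgroupOfEquivOfLe hDle)
      (Subgroup.subgroupOfEquivOfLe hDle).surjective
    exact (Subgroup.isCyclic_iff_exists_zpowers_eq_top D).mp this
  have hyN : (Subgroup.zpowers y).Normal := hy ▸ Subgroup.normalCore_normal _
  -- Every conjugate of x lies in A, so its n-th power lies in ⟨x⟩, where n is the index of ⟨x⟩ in
  -- A. Thus passing to the normal core costs at most a factor n.
  have hxD : (x : P) ^ n ∈ D := fun g => by
    obtain ⟨k, hk⟩ := (Subgroup.zpowers x).pow_index_mem ⟨_, hA.conj_mem x x.2 g⟩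
    refine ⟨k, ?_⟩
    have := congrArg Subtype.val hk
    show (x : P) ^ k = g * (x : P) ^ n * g⁻¹
    rw [← conj_pow]
    simpa using this
  have hxDle : Subgroup.zpowers ((x : P) ^ n) ≤ D := Subgroup.zpowers_le.mpr hxD
  set M := p ^ (2 * Nat.log p K) with hM
  have hM0 : 0 < M := pow_pos hp.out.pos _
  have hMK : M ≤ K * K := by
    rw [hM, two_mul, pow_add]
    have := Nat.pow_log_le_self p (x := K) (by omega)
    exact Nat.mul_le_mul this this
  have h1 : D.relIndex A ≤ n * n := by
    have h2 : (Subgroup.zpowers ((x : P) ^ n)).relIndex A ≤ n * n := by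
      rw [← Subgroup.relIndex_mul_relIndex _ _ _ (hxDle.trans hDle) hxA, relIndex_zpowers_coe]
      exact Nat.mul_le_mul (relIndex_zpowers_pow_le _ n hn0) le_rfl
    rw [← Subgroup.relIndex_mul_relIndex _ _ _ hxDle (hDle.trans hxA)] at h2
    exact le_trans (Nat.le_mul_of_pos_left _ (Nat.pos_of_ne_zero
      (Subgroup.FiniteIndex.index_ne_zero))) h2
  have hyM : Subgroup.zpowers (y ^ M) ≤ D :=
    hy ▸ Subgroup.zpowers_le.mpr (Subgroup.pow_mem _ (Subgroup.mem_zpowers y) M)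
  have h2 : (Subgroup.zpowers (y ^ M)).relIndex A ≤ K ^ 6 := by
    rw [← Subgroup.relIndex_mul_relIndex _ _ _ hyM (hDle.trans hxA), ← hy]
    rw [← hy] at h1
    calc _ ≤ M * (n * n) := Nat.mul_le_mul (relIndex_zpowers_pow_le _ M hM0) h1
      _ ≤ (K * K) * ((K * K) * (K * K)) := by gcongr
      _ = K ^ 6 := by ring
  exact ⟨y ^ M, index_zpowers_le_of_centralizer_eq hAc
    (hxA (hDle (hyM (Subgroup.mem_zpowers _)))) (hT.index_centralizer_pow_le hP hK2 y) h2⟩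

theorem DisjointSubgroupsBounded.mono {K L : ℕ} {G : Type*} [Group G]
    (h : DisjointSubgroupsBounded K G) (hKL : K ≤ L) : DisjointSubgroupsBounded L G :=
  fun H H' hd => (h H H' hd).imp (·.trans hKL) (·.trans hKL)

/-- If one of any two subgroups meeting trivially has bounded order, then there is a nontrivial
cyclic `p`-subgroup of bounded index. -/
theorem exists_index_zpowers_le (K : ℕ) : ∃ B : ℕ, ∀ (G : Type u) [Group G] [Finite G]
    [Nontrivial G], DisjointSubgroupsBounded K G →
      ∃ (g : G) (p k : ℕ), p.Prime ∧ orderOf g = p ^ (k + 1) ∧ (Subgroup.zpowers g).index ≤ B := by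
  set L := max K 2 with hL
  refine ⟨L ^ 6 * ((L ^ 6 * L ^ 6) ^ L ^ 6 * 4) * L.factorial, fun G _ _ _ h => ?_⟩
  replace h := h.mono (le_max_left K 2)
  obtain ⟨p, hp, P, hP⟩ := exists_sylow_index_dvd_factorial h
  have := Fact.mk hp
  obtain ⟨y, hy⟩ := P.isPGroup'.exists_index_zpowers_le
    (h.of_injective P.1.subtype P.1.subtype_injective) (le_max_right K 2)
  have hind : (Subgroup.zpowers (y : G)).index ≤ L ^ 6 * ((L ^ 6 * L ^ 6) ^ L ^ 6 * 4) *
      L.factorial := by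
    rw [← Subgroup.relIndex_mul_index (Subgroup.zpowers_le.mpr y.2)]
    refine Nat.mul_le_mul ?_ (Nat.le_of_dvd (Nat.factorial_pos _) hP)
    exact (relIndex_zpowers_coe y).trans_le hy
  obtain ⟨k, hk⟩ := IsPGroup.iff_orderOf.mp P.isPGroup' y
  rw [← Subgroup.orderOf_coe] at hk
  rcases k with _ | k
  -- With y trivial the bound on its index bounds |G|, so any element of prime order will do.
  · have hy1 : (y : G) = 1 := by simpa using hk
    obtain ⟨q, hq, hdvd⟩ := Nat.exists_prime_and_dvd (Finite.one_lt_card (α := G)).ne'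
    have := Fact.mk hq
    obtain ⟨g, hg⟩ := exists_prime_orderOf_dvd_card' q hdvd
    refine ⟨g, q, 0, hq, by simpa using hg, le_trans ?_ hind⟩
    rw [hy1, Subgroup.zpowers_one_eq_bot, Subgroup.index_bot]
    exact Nat.le_of_dvd Nat.card_pos (Subgroup.index_dvd_card _)
  · exact ⟨y, p, k, hp, hk, hind⟩

/-! ### The estimate for the degree -/

/-- Every nontrivial subgroup of a cyclic p-group contains its unique subgroup of order p. -/
theorem disjoint_zpowers_of_notMem {G : Type*} [Group G] {g : G} {p k : ℕ} (hp : p.Prime)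
    (hg : orderOf g = p ^ (k + 1)) {H : Subgroup G} (hH : g ^ p ^ k ∉ H) :
    Disjoint H (Subgroup.zpowers g) := by
  rw [Subgroup.disjoint_def]
  intro b hbH hb
  obtain ⟨n, rfl⟩ := Subgroup.mem_zpowers_iff.mp hb
  have hone : ∀ i : ℤ, g ^ ((p : ℤ) ^ (k + 1) * i) = 1 := fun i => by
    rw [← orderOf_dvd_iff_zpow_eq_one, hg]
    push_cast
    exact dvd_mul_right _ _
  obtain ⟨s, hs, e, rfl, hor⟩ := exists_le_pow_dvd_and p n (k + 1)
  by_cases hsk : s = k + 1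
  · rw [hsk, hone]
  · exfalso
    obtain ⟨α, β, hαβ⟩ := Int.exists_mul_add_mul_pow_eq_one hp (hor.resolve_left hsk) (k + 1)
    have hps : (p : ℤ) ^ s * p ^ (k - s) = p ^ k := by
      rw [← pow_add, Nat.add_sub_cancel' (by omega)]
    have : g ^ p ^ k = (g ^ ((p : ℤ) ^ s * e)) ^ (α * (p : ℤ) ^ (k - s)) := by
      rw [← zpow_mul, ← mul_one (g ^ ((p : ℤ) ^ s * e * (α * (p : ℤ) ^ (k - s)))),
        ← hone (β * p ^ k), ← zpow_add, ← zpow_natCast]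
      congr 1
      push_cast
      linear_combination (-(p : ℤ) ^ k) * hαβ - (e * α) * hps
    exact hH (this ▸ H.zpow_mem hbH _)

theorem groupDegree_estimate {c : ℝ} (hc : 0 < c) :
    ∃ C : ℕ, ∀ (G : Type u) [Group G] [Finite G],
      c * (Nat.card G : ℝ) ≤ (groupDegree G : ℝ) →
      ∃ m : ℕ, 0 < m ∧ (Nat.card G : ℝ) / m ≤ groupDegree G ∧
        (groupDegree G : ℝ) ≤ (Nat.card G : ℝ) / m + C := by
  obtain ⟨B, hB⟩ := exists_index_zpowers_le.{u} ⌈2 / c⌉₊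
  refine ⟨B, fun G _ _ h => ?_⟩
  have hcard : (0 : ℝ) < Nat.card G := mod_cast Nat.card_pos
  rcases subsingleton_or_nontrivial G with hG | hG
  · have h0 : groupDegree G ≤ 0 := by
      simpa using groupDegree_le_card_of_injective (1 : G →* Equiv.Perm Empty)
        (Function.injective_of_subsingleton _)
    rw [Nat.le_zero.mp h0] at h
    exact absurd h (not_le.mpr (by simpa using mul_pos hc hcard))
  obtain ⟨g, p, k, hp, hg, hi⟩ := hB G (disjointSubgroupsBounded_of_le_groupDegree hc h)
  have hz : g ^ p ^ k ≠ 1 := by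
    rw [Ne, ← orderOf_dvd_iff_pow_eq_one, hg, Nat.pow_dvd_pow_iff_le_right hp.one_lt]
    omega
  obtain ⟨H, hH, hmax⟩ := Set.exists_max_image {H : Subgroup G | g ^ p ^ k ∉ H}
    (fun H => Nat.card H) (Set.toFinite _) ⟨⊥, by simpa using hz⟩
  have hm : (0 : ℝ) < Nat.card H := mod_cast Nat.card_pos
  refine ⟨Nat.card H, Nat.card_pos, ?_, ?_⟩
  · rw [div_le_iff₀ hm, mul_comm]
    exact mod_cast card_le_mul_groupDegree hz hmax
  · have h1 : (groupDegree G : ℝ) ≤ H.index + B := by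
      exact_mod_cast (groupDegree_le_index_add_index (disjoint_zpowers_of_notMem hp hg hH)).trans
        (Nat.add_le_add_left hi _)
    have h2 : (Nat.card H : ℝ) * H.index = Nat.card G := mod_cast H.card_mul_index
    rwa [← h2, mul_div_cancel_left₀ _ hm.ne']

theorem relDegree_estimate {c : ℝ} (hc : 0 < c) :
    ∃ C : ℕ, ∀ (G : Type u) [Group G] [Finite G], c ≤ relDegree G →
      ∃ m : ℕ, 0 < m ∧ 1 / (m : ℝ) ≤ relDegree G ∧
        relDegree G ≤ 1 / (m : ℝ) + C / (Nat.card G : ℝ) := by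
  obtain ⟨C, hC⟩ := groupDegree_estimate.{u} hc
  refine ⟨C, fun G _ _ h => ?_⟩
  have hcard : (0 : ℝ) < Nat.card G := mod_cast Nat.card_pos
  obtain ⟨m, hm, h1, h2⟩ := hC G ((le_div_iff₀ hcard).mp h)
  have hm' : (0 : ℝ) < m := mod_cast hm
  refine ⟨m, hm, ?_, ?_⟩
  · rw [relDegree, le_div_iff₀ hcard]
    rwa [one_div_mul_eq_div]
  · rw [relDegree, div_le_iff₀ hcard]
    rwa [add_mul, one_div_mul_eq_div, div_mul_cancel₀ _ hcard.ne']

/-! ### Limit points and accumulation points -/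

theorem relDegree_nonneg (G : Type u) [Group G] : 0 ≤ relDegree G := by
  unfold relDegree
  positivity

theorem relDegree_le_one (G : Type u) [Group G] [Finite G] : relDegree G ≤ 1 :=
  div_le_one_of_le₀ (mod_cast groupDegree_le_card G) (Nat.cast_nonneg _)

theorem IsRelDegreeLimitPoint.exists_eq_one_div {a : ℝ} (ha0 : a ≠ 0)
    (ha : IsRelDegreeLimitPoint.{u} a) : ∃ n : ℕ, 0 < n ∧ a = 1 / (n : ℝ) := by
  have hpos : 0 < a := by
    by_contra! hle
    have hlt : a < 0 := lt_of_le_of_ne hle ha0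
    obtain ⟨G, _, _, -, h⟩ := ha (-a) (by linarith) 0
    have := (abs_lt.mp h).2
    linarith [relDegree_nonneg G]
  obtain ⟨C, hC⟩ := relDegree_estimate.{u} (half_pos hpos)
  obtain ⟨M, hM⟩ := exists_nat_gt (2 / a)
  -- Values of Δ near a exceed a/2, which bounds m. So a is in the closure of a finite, hence
  -- closed, set.
  let F : Set ℝ := (fun m : ℕ => 1 / (m : ℝ)) '' {m | 0 < m ∧ m ≤ M}
  have hF : F.Finite := Set.Finite.image _ ((Set.finite_Iic M).subset fun m hm => hm.2)
  have haF : a ∈ closure F := by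
    rw [Metric.mem_closure_iff]
    intro ε hε
    set δ := min (ε / 2) (a / 4) with hδ
    have hδ0 : 0 < δ := lt_min (half_pos hε) (by linarith)
    obtain ⟨N, hN⟩ := exists_nat_gt (C / δ)
    obtain ⟨G, _, _, hG, h⟩ := ha δ hδ0 N
    have h1 := abs_lt.mp h
    have hδ1 : δ ≤ ε / 2 := min_le_left _ _
    have hδ2 : δ ≤ a / 4 := min_le_right _ _
    obtain ⟨m, hm, hm1, hm2⟩ := hC G (by linarith)
    have hm' : (0 : ℝ) < m := mod_cast hm
    have hcard : (C : ℝ) / Nat.card G < δ := by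
      have h2 : (C : ℝ) / δ < Nat.card G := hN.trans (mod_cast hG)
      rw [div_lt_iff₀ hδ0] at h2
      rw [div_lt_iff₀ (mod_cast Nat.card_pos)]
      linarith
    refine ⟨1 / m, ⟨m, ⟨hm, ?_⟩, rfl⟩, ?_⟩
    · have h3 : a / 2 < 1 / m := by linarith
      rw [lt_div_iff₀ hm'] at h3
      rw [div_lt_iff₀ hpos] at hM
      have : (m : ℝ) < M := lt_of_mul_lt_mul_right (by linarith) hpos.le
      exact_mod_cast this.le
    · rw [Real.dist_eq, abs_lt]
      constructor <;> linarith
  rw [hF.isClosed.closure_eq] at haF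
  obtain ⟨m, hm, rfl⟩ := haF
  exact ⟨m, hm.1, rfl⟩

theorem AccPt.exists_relDegree {a : ℝ} (ha : AccPt a (𝓟 relDegreeSet.{u})) {ε : ℝ} (hε : 0 < ε)
    (N : ℕ) : ∃ (G : Type u) (_ : Group G) (_ : Finite G),
      N < Nat.card G ∧ |relDegree G - a| < ε ∧ relDegree G ≠ a := by
  -- F contains all values from groups of order at most N; removing this finite set, apart from a,
  -- forces large order.
  let F : Set ℝ := (fun q : ℕ × ℕ => (q.1 : ℝ) / q.2) '' (Set.Iic N ×ˢ Set.Iic N)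
  have hF : F.Finite := ((Set.finite_Iic N).prod (Set.finite_Iic N)).image _
  have hU : Metric.ball a ε ∩ (F \ {a})ᶜ ∈ 𝓝 a :=
    Filter.inter_mem (Metric.ball_mem_nhds a hε)
      ((hF.subset Set.sdiff_subset).isClosed.isOpen_compl.mem_nhds (by simp))
  obtain ⟨_, ⟨⟨hball, hnF⟩, G, _, _, rfl⟩, hne⟩ := accPt_iff_nhds.mp ha _ hU
  refine ⟨G, inferInstance, inferInstance, ?_, hball, hne⟩
  by_contra! hle
  exact hnF ⟨⟨(groupDegree G, Nat.card G), ⟨(groupDegree_le_card G).trans hle, hle⟩, rfl⟩, hne⟩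

theorem AccPt.exists_eq_one_div {a : ℝ} (ha0 : a ≠ 0) (ha : AccPt a (𝓟 relDegreeSet.{u})) :
    ∃ n : ℕ, 2 ≤ n ∧ a = 1 / (n : ℝ) := by
  have hlim : IsRelDegreeLimitPoint.{u} a := fun ε hε N => by
    obtain ⟨G, h1, h2, h3, h4, -⟩ := ha.exists_relDegree hε N
    exact ⟨G, h1, h2, h3, h4⟩
  obtain ⟨n, hn, rfl⟩ := hlim.exists_eq_one_div ha0
  refine ⟨n, ?_, rfl⟩
  by_contra! hlt
  obtain rfl : n = 1 := by omega
  obtain ⟨C, hC⟩ := relDegree_estimate.{u} (c := 1 / 2) (by norm_num)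
  obtain ⟨G, _, _, hG, hd, hne⟩ := ha.exists_relDegree (ε := 1 / 4) (by norm_num) (4 * C)
  have hd := (abs_lt.mp hd).1
  norm_num at hd hne
  obtain ⟨m, hm, hm1, hm2⟩ := hC G (by linarith)
  have hm' : (0 : ℝ) < m := mod_cast hm
  have hcard : (C : ℝ) / Nat.card G < 1 / 4 := by
    have : (4 * C : ℝ) < Nat.card G := mod_cast hG
    rw [div_lt_iff₀ (mod_cast Nat.card_pos)]
    linarith
  have h1 : 1 / 2 < 1 / (m : ℝ) := by linarith
  have h2 : (m : ℝ) < 2 := lt_of_one_div_lt_one_div two_pos h1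
  -- With m = 1 the lower bound reads Δ(G) ≥ 1, so Δ(G) = 1, contrary to the punctured
  -- neighbourhood.
  obtain rfl : m = 1 := by
    have : m < 2 := mod_cast h2
    omega
  norm_num at hm1
  exact hne (le_antisymm (relDegree_le_one G) hm1)

/-! ### Products with a group of prime order -/

section Product

variable {A B : Type u} [CommGroup A] [CommGroup B] [Finite B]

theorem groupDegree_prod_le [Finite A] : groupDegree (A × B) ≤ Nat.card A + Nat.card B := by
  have hd : Disjoint (MonoidHom.fst A B).ker (MonoidHom.snd A B).ker := by
    rw [Subgroup.disjoint_def]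
    exact fun h1 h2 => Prod.ext h1 h2
  refine (groupDegree_le_index_add_index hd).trans_eq ?_
  rw [Subgroup.index_ker, Subgroup.index_ker,
    MonoidHom.range_eq_top.mpr (fun a => ⟨(a, 1), rfl⟩),
    MonoidHom.range_eq_top.mpr (fun b => ⟨(1, b), rfl⟩), Subgroup.card_top, Subgroup.card_top]

/-- A nontrivial element of H ∩ (A × 1) would generate A × 1, so H projects injectively to B. -/
theorem card_le_of_notMem_of_prime {p : ℕ} (hp : p.Prime) (hA : Nat.card A = p) {a : A}
    {H : Subgroup (A × B)} (hH : (a, 1) ∉ H) : Nat.card H ≤ Nat.card B := by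
  refine Nat.card_le_card_of_injective (fun h : H => h.1.2) ?_
  have key : Function.Injective ((MonoidHom.snd A B).comp H.subtype) := by
    rw [injective_iff_map_eq_one]
    rintro ⟨⟨x, y⟩, hxy⟩ hy
    obtain rfl : y = 1 := hy
    have := Fact.mk hp
    by_contra hx
    have hx1 : x ≠ 1 := by
      rintro rfl
      exact hx rfl
    obtain ⟨k, hk⟩ := Subgroup.mem_zpowers_iff.mp (mem_zpowers_of_prime_card hA hx1 (g' := a))
    have := H.zpow_mem hxy k
    rw [Prod.pow_mk, hk, one_zpow] at this
    exact hH this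
  exact key

theorem card_lt_groupDegree_prod [Finite A] {p : ℕ} (hp : p.Prime) (hA : Nat.card A = p)
    (hB : 2 ≤ Nat.card B) : p < groupDegree (A × B) := by
  have : Nontrivial A := Finite.one_lt_card_iff_nontrivial.mp (hA ▸ hp.one_lt)
  obtain ⟨a, ha⟩ := exists_ne (1 : A)
  have hz : ((a, 1) : A × B) ≠ 1 := fun h => ha (congrArg Prod.fst h)
  obtain ⟨f, hf⟩ := exists_injective_perm_groupDegree (A × B)
  by_contra! hle
  obtain ⟨i, hi⟩ : ∃ i, f (a, 1) i ≠ i := by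
    by_contra! h
    exact hz (hf (by ext i; simp [h i]))
  let _ : MulAction (A × B) (Fin (groupDegree (A × B))) := MulAction.compHom _ f
  set S := MulAction.stabilizer (A × B) i with hS
  have hSB : Nat.card S ≤ Nat.card B := card_le_of_notMem_of_prime hp hA (H := S) fun h => hi h
  have hSi : p ≤ S.index := by
    have h1 := S.card_mul_index
    rw [Nat.card_prod, hA, mul_comm p] at h1
    refine Nat.le_of_mul_le_mul_left (h1.symm.le.trans (Nat.mul_le_mul_right _ hSB)) Nat.card_pos
  -- An action on at most p points is therefore transitive. Stabilizers of a transitive abelian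
  -- action fix every point, so faithfulness makes S trivial and |A × B| ≤ p.
  have horb : MulAction.orbit (A × B) i = Set.univ := by
    refine Set.eq_of_subset_of_ncard_le (Set.subset_univ _) ?_
    rw [← MulAction.index_stabilizer, Set.ncard_univ, Nat.card_fin]
    exact hle.trans hSi
  have hbot : S = ⊥ := by
    rw [eq_bot_iff]
    intro s hs
    refine hf ?_
    rw [map_one]
    ext j
    obtain ⟨g, rfl⟩ : j ∈ MulAction.orbit (A × B) i := horb ▸ Set.mem_univ j
    have h1 : s • g • i = g • s • i := smul_comm s g i
    have h2 : s • i = i := hs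
    rw [h2] at h1
    exact congrArg Fin.val h1
  have h1 := S.card_mul_index
  rw [hbot, Subgroup.card_bot, one_mul, ← hbot, Nat.card_prod, hA] at h1
  have h2 : S.index ≤ p := by
    rw [MulAction.index_stabilizer, horb, Set.ncard_univ, Nat.card_fin]
    exact hle
  have := hp.pos
  nlinarith

theorem card_le_groupDegree_prod [Finite A] {p : ℕ} (hp : p.Prime) (hA : Nat.card A = p) :
    p ≤ groupDegree (A × B) := by
  have : Nontrivial A := Finite.one_lt_card_iff_nontrivial.mp (hA ▸ hp.one_lt)
  obtain ⟨a, ha⟩ := exists_ne (1 : A)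
  have hz : ((a, 1) : A × B) ≠ 1 := fun h => ha (congrArg Prod.fst h)
  have := card_le_mul_groupDegree hz fun H hH => card_le_of_notMem_of_prime hp hA hH
  rw [Nat.card_prod, hA, mul_comm] at this
  exact Nat.le_of_mul_le_mul_left this Nat.card_pos

end Product

theorem exists_relDegree_near_one_div {n : ℕ} (hn : 0 < n) {ε : ℝ} (hε : 0 < ε) (N : ℕ) :
    ∃ (G : Type u) (_ : Group G) (_ : Finite G),
      N < Nat.card G ∧ |relDegree G - 1 / n| < ε ∧ (2 ≤ n → relDegree G ≠ 1 / n) := by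
  obtain ⟨M, hM⟩ := exists_nat_gt (1 / ε)
  obtain ⟨p, hle, hp⟩ := Nat.exists_infinite_primes (max (N + 1) M)
  have : NeZero n := ⟨hn.ne'⟩
  have : NeZero p := ⟨hp.ne_zero⟩
  let A := ULift.{u} (Multiplicative (ZMod p))
  let B := ULift.{u} (Multiplicative (ZMod n))
  have hA : Nat.card A = p := by
    rw [Nat.card_congr (Equiv.ulift.trans Multiplicative.toAdd), Nat.card_zmod]
  have hB : Nat.card B = n := by
    rw [Nat.card_congr (Equiv.ulift.trans Multiplicative.toAdd), Nat.card_zmod]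
  have hcard : Nat.card (A × B) = p * n := by rw [Nat.card_prod, hA, hB]
  have hn' : (0 : ℝ) < n := mod_cast hn
  have hp' : (0 : ℝ) < p := mod_cast hp.pos
  have hdef : relDegree (A × B) - 1 / n = (groupDegree (A × B) - p) / (p * n) := by
    rw [relDegree, hcard]
    push_cast
    field_simp
  refine ⟨A × B, inferInstance, inferInstance, ?_, ?_, fun h2 => ?_⟩
  · rw [hcard]
    have := (le_max_left _ _).trans hle
    nlinarith
  · have h1 : (p : ℝ) ≤ groupDegree (A × B) := mod_cast card_le_groupDegree_prod hp hA
    have h2 : (groupDegree (A × B) : ℝ) ≤ p + n := by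
      have := groupDegree_prod_le (A := A) (B := B)
      rw [hA, hB] at this
      exact_mod_cast this
    have h3 : 1 / ε < p := hM.trans_le (mod_cast (le_max_right _ _).trans hle)
    rw [div_lt_iff₀ hε] at h3
    rw [hdef, abs_of_nonneg (div_nonneg (by linarith) (by positivity)),
      div_lt_iff₀ (by positivity)]
    nlinarith
  · have h1 : (p : ℝ) < groupDegree (A × B) :=
      mod_cast card_lt_groupDegree_prod hp hA (hB.symm ▸ h2)
    rw [← sub_ne_zero, hdef]
    exact (div_pos (by linarith) (by positivity)).ne'

theorem mainTheorem4 :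
    -- the limit of a sequence, if positive, is `1 / l`
    (∀ (G : ℕ → Type u) [∀ n, Group (G n)] [∀ n, Finite (G n)] (L : ℝ),
      Tendsto (fun n => Nat.card (G n)) atTop atTop →
      Tendsto (fun n => relDegree (G n)) atTop (𝓝 L) →
      0 < L →
      ∃ l : ℕ, 0 < l ∧ L = 1 / (l : ℝ)) ∧
    -- the nonzero limit points of `Δ(G)` as `|G| → ∞` are exactly the numbers `1 / n`
    (∀ a : ℝ, a ≠ 0 →
      (IsRelDegreeLimitPoint.{u} a ↔ ∃ n : ℕ, 0 < n ∧ a = 1 / (n : ℝ))) ∧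
    -- the nonzero accumulation points of the set of values are these numbers, except that `1`
    -- is an isolated value
    (∀ a : ℝ, a ≠ 0 →
      (AccPt a (𝓟 relDegreeSet.{u}) ↔ ∃ n : ℕ, 2 ≤ n ∧ a = 1 / (n : ℝ))) ∧
    -- `d(G) ≥ c |G|` implies `d(G) = |G| / m + O_c(1)`
    (∀ c : ℝ, 0 < c → ∃ C : ℝ, ∀ (G : Type u) [Group G] [Finite G],
      c * (Nat.card G : ℝ) ≤ (groupDegree G : ℝ) →
      ∃ m : ℕ, 0 < m ∧ |(groupDegree G : ℝ) - (Nat.card G : ℝ) / (m : ℝ)| ≤ C) := by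

  refine ⟨?_, ?_, ?_, ?_⟩
  · intro G _ _ L hcard hlim hL
    refine IsRelDegreeLimitPoint.exists_eq_one_div.{u} hL.ne' fun ε hε N => ?_
    obtain ⟨n, h1, h2⟩ := ((hcard.eventually_gt_atTop N).and
      (hlim.eventually (Metric.ball_mem_nhds L hε))).exists
    exact ⟨G n, inferInstance, inferInstance, h1, h2⟩
  · refine fun a ha => ⟨fun h => h.exists_eq_one_div ha, ?_⟩
    rintro ⟨n, hn, rfl⟩ ε hε N
    obtain ⟨G, h1, h2, h3, h4, -⟩ := exists_relDegree_near_one_div hn hε N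
    exact ⟨G, h1, h2, h3, h4⟩
  · refine fun a ha => ⟨fun h => h.exists_eq_one_div ha, ?_⟩
    rintro ⟨n, hn, rfl⟩
    rw [accPt_iff_nhds]
    intro U hU
    obtain ⟨ε, hε, hball⟩ := Metric.mem_nhds_iff.mp hU
    obtain ⟨G, h1, h2, -, h4, h5⟩ := exists_relDegree_near_one_div (by omega : 0 < n) hε 0
    exact ⟨relDegree G, ⟨hball h4, G, h1, h2, rfl⟩, h5 hn⟩
  · intro c hc
    obtain ⟨C, hC⟩ := groupDegree_estimate.{u} hc
    refine ⟨C, fun G _ _ h => ?_⟩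
    obtain ⟨m, hm, h1, h2⟩ := hC G h
    exact ⟨m, hm, abs_le.mpr ⟨by linarith [C.cast_nonneg (α := ℝ)], by linarith⟩⟩
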